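/- For $k,n,m\in\mathbb{N}$ let $\Delta_n^k$ be the set of conditional distributions $p(y|x)$, $x\in\{0,1\}^k$, $y\in\{0,1\}^n$ (row-stochastic $2^k\times 2^n$ matrices). Let $\mathrm{RBM}_{n,m}^k\subseteq\Delta_n^k$ be the conditional restricted Boltzmann machine with $k$ input, $n$ output and $m$ hidden units, i.e. the set of all $p\in\Delta_n^k$ of the form $$p(y|x)=\frac{1}{Z(x)}\sum_{z\in\{0,1\}^m}\exp(z^\top Vx+z^\top Wy+b^\top y+c^\top z),\qquad Z(x)=\sum_{y}\sum_{z}\exp(z^\top Vx+z^\top Wy+b^\top y+c^\top z),$$ with $V\in\mathbb{R}^{m\times k}$, $W\in\mathbb{R}^{m\times n}$, $b\in\mathbb{R}^n$, $c\in\mathbb{R}^m$. For $p,q\in\Delta_n^k$ put $D(p\|q)=2^{-k}\sum_x\sum_y p(y|x)\log_2\frac{p(y|x)}{q(y|x)}$ (with value $+\infty$ if $q(y|x)=0<p(y|x)$ for some $x,y$), and let $$D_{\mathrm{RBM}_{n,m}^k}=\sup_{p\in\Delta_n^k}\ \inf_{q\in \mathrm{RBM}_{n,m}^k}D(p\|q).$$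 Let $l\in\{1,\dots,n\}$. Then $D_{\mathrm{RBM}_{n,m}^k}\le n-l$ whenever one of the following holds: - $k\ge 1$ and $m\ge\frac12 2^k(2^l-1)$; - $k\ge 3$ and $m\ge\frac38 2^k(2^l-1)+1$; - $k\ge 21$ and $m\ge\frac14 2^k\left(2^l-1+\frac1{30}\right)$. More generally, let $r\ge1$ be an integer with $k\ge S(r):=1+2+\cdots+r$. Put $F(1)=1$ and $F(i)=2^{S(i-1)}+(2^i-(i+1))F(i-1)$ for $i\ge2$, and put $R(1)=0$ and $R(r)=\prod_{i=2}^r(2^i-(i+1))$ for $r\ge2$. Then $D_{\mathrm{RBM}_{n,m}^k}\le n-l$ for every integer $l\le n$ with $m\ge 2^{k-S(r)}F(r)(2^l-1)+R(r)$, in particular for the largest such $l$. -/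

import Mathlib

namespace CRBM

/-- The state space `{0,1}^n`. -/
abbrev Cube (n : ℕ) : Type := Fin n → Fin 2

/-- A binary state vector, read as a real column vector with entries `0` and `1`. -/
def toVec {n : ℕ} (x : Cube n) : Fin n → ℝ := fun i => ((x i : ℕ) : ℝ)

/-- The conditional distributions of an output `y ∈ {0,1}^n` given an input `x ∈ {0,1}^k`: the
row-stochastic matrices, with `p x y` standing for `p(y|x)`. -/
def condDistributions (k n : ℕ) : Set (Cube k → Cube n → ℝ) :=
  {p | ∀ x, p x ∈ stdSimplex ℝ (Cube n)}

open scoped Matrix in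
/-- The unnormalized weight
`∑_{z ∈ {0,1}^m} exp (zᵀ V x + zᵀ W y + bᵀ y + cᵀ z)` of the output `y` given the input `x`. -/
noncomputable def weight {k n m : ℕ} (V : Matrix (Fin m) (Fin k) ℝ)
    (W : Matrix (Fin m) (Fin n) ℝ) (b : Fin n → ℝ) (c : Fin m → ℝ)
    (x : Cube k) (y : Cube n) : ℝ :=
  ∑ z : Cube m, Real.exp (toVec z ⬝ᵥ (V *ᵥ toVec x) + toVec z ⬝ᵥ (W *ᵥ toVec y)
    + b ⬝ᵥ toVec y + c ⬝ᵥ toVec z)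

/-- The conditional restricted Boltzmann machine with `k` input units, `n` output units and `m`
hidden units. -/
def model (k n m : ℕ) : Set (Cube k → Cube n → ℝ) :=
  {p | p ∈ condDistributions k n ∧
    ∃ (V : Matrix (Fin m) (Fin k) ℝ) (W : Matrix (Fin m) (Fin n) ℝ) (b : Fin n → ℝ) (c : Fin m → ℝ),
      ∀ x y, p x y = weight V W b c x y / ∑ y' : Cube n, weight V W b c x y'}

open Classical in
/-- The Kullback-Leibler divergence `D(p ‖ q)` of two probability vectors on `{0,1}^n`, in bits.
It is `⊤` if `p` is not absolutely continuous with respect to `q`. Terms with `p y = 0` vanish. -/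
noncomputable def klDivergence {n : ℕ} (p q : Cube n → ℝ) : EReal :=
  if ∀ y, q y = 0 → p y = 0 then ((∑ y, p y * Real.logb 2 (p y / q y) : ℝ) : EReal) else ⊤

/-- The divergence of two conditional distributions: the divergence of the rows, averaged over the
inputs with respect to the uniform distribution on `{0,1}^k`. -/
noncomputable def condDivergence {k n : ℕ} (p q : Cube k → Cube n → ℝ) : EReal :=
  ∑ x : Cube k, (((1 / 2 ^ k : ℝ) : EReal) * klDivergence (p x) (q x))

/-- The divergence from a conditional distribution `p` to a set `M` of conditional
distributions. -/
noncomputable def divergenceTo {k n : ℕ} (p : Cube k → Cube n → ℝ)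
    (M : Set (Cube k → Cube n → ℝ)) : EReal :=
  ⨅ q ∈ M, condDivergence p q

/-- The maximal divergence from a conditional distribution to a set `M` of conditional
distributions. -/
noncomputable def maxDivergence {k n : ℕ} (M : Set (Cube k → Cube n → ℝ)) : EReal :=
  ⨆ p ∈ condDistributions k n, divergenceTo p M

/-- `S(r) = 1 + 2 + ⋯ + r`. -/
def S (r : ℕ) : ℕ := ∑ i ∈ Finset.Icc 1 r, i

/-- `f_i(z) = 2^{S(i-1)} + (2^i - (i+1)) z` for `i ≥ 1`; the subtraction does not truncate. -/
def f (i z : ℕ) : ℕ := 2 ^ S (i - 1) + (2 ^ i - (i + 1)) * z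

/-- `F(1) = 1` and `F(r) = f_r(f_{r-1}(⋯ f_2(1)))`. The value at `0` is not used. -/
def F : ℕ → ℕ
  | 0 => 0
  | 1 => 1
  | r + 2 => f (r + 2) (F (r + 1))

/-- `R(1) = 0`, and `R(r) = ∏_{i=2}^r (2^i - (i+1))` for `r ≥ 2`; the subtraction does not
truncate. -/
def R (r : ℕ) : ℕ := if r ≤ 1 then 0 else ∏ i ∈ Finset.Icc 2 r, (2 ^ i - (i + 1))

end CRBM

/-!
Summing out the hidden units writes the weight of `(x, y)` as `exp (b ⬝ y)` times one factor
`1 + exp t(x, y)`, with `t` affine, for each hidden unit (`weight_eq`, `exists_weight`). It suffices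
to approximate positive conditional distributions that are constant on the blocks of outputs
with the same first `l` bits: replacing `p` by its block averages costs at most `n - l` bits, because
the block average is at least `2^(l-n) p` (`maxDivergence_model_le_of_steerable`).

A large negative bias concentrates the initial distribution on the block `0`. A unit can be
concentrated on one block `y₀` and on a subcube of inputs; it then adds to the weight of `y₀` a term
whose logarithm is an affine function of the input on this subcube. On a star, that is a vertex of
the subcube together with its neighbours, an affine function takes arbitrary values. Hence
`2^l - 1` units set all block probabilities on a star, and the number of units is essentially
`2^l - 1` times the number of stars in a partition of the input cube. The recursion for `F` counts
the stars in the following partition of `{0,1}^(S r)`: one star in each of the `2^(S (r-1))` parallel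
`r`-cubes, and recursively a partition of each of the remaining `2^r - (r+1)` parallel copies of
`{0,1}^(S (r-1))`.

A unit of a star also acts on the other inputs of its subcube. This is repaired by a few base units,
which raise the weight of the block `0` there so much that the unwanted ratios become negligible,
after which those inputs can be treated recursively. The limit `s → ∞` of all these scales is
organized by the notion `Steerable`, whose recursion is `Steerable.star`. For it to go through, the
base units of the recursive scheme must act only over the remaining inputs `v`, `|v| ≥ 2`. One copy
of each base unit for each threshold `2, …, r` of `|v|` achieves this, so the number of base units
obeys `B(r) = (r-1) B(r-1) + 1`. This is `baseCount r ≤ R r`; moreover `baseCount 6 = 206`, and the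
bound for `k ≥ 21` rests on this value, as `R 6 = 65208` would be too large for `l = 1`.
-/

open Filter Topology

namespace CRBM

/-! ### Affine functions on the cube -/

/-- A real function on `{0,1}^ι` that is affine in the coordinates. -/
def IsAffine {ι : Type} [Fintype ι] (g : (ι → Fin 2) → ℝ) : Prop :=
  ∃ (c : ℝ) (v : ι → ℝ), ∀ x, g x = c + ∑ i, v i * ((x i : ℕ) : ℝ)

namespace IsAffine

variable {ι κ : Type} [Fintype ι] [Fintype κ]

lemma const (c : ℝ) : IsAffine (fun _ : ι → Fin 2 => c) := ⟨c, 0, by simp⟩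

lemma coord (i : ι) : IsAffine (fun x : ι → Fin 2 => ((x i : ℕ) : ℝ)) := by
  classical
  exact ⟨0, Pi.single i 1, fun x => by simp [Pi.single_apply]⟩

lemma add {f g : (ι → Fin 2) → ℝ} (hf : IsAffine f) (hg : IsAffine g) :
    IsAffine (fun x => f x + g x) := by
  obtain ⟨c, v, h⟩ := hf
  obtain ⟨c', v', h'⟩ := hg
  refine ⟨c + c', v + v', fun x => ?_⟩
  simp only [h, h', Pi.add_apply, add_mul, Finset.sum_add_distrib]
  ring

lemma const_mul {f : (ι → Fin 2) → ℝ} (r : ℝ) (hf : IsAffine f) :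
    IsAffine (fun x => r * f x) := by
  obtain ⟨c, v, h⟩ := hf
  refine ⟨r * c, r • v, fun x => ?_⟩
  simp only [h, mul_add, Finset.mul_sum, Pi.smul_apply, smul_eq_mul, mul_assoc]

lemma sub {f g : (ι → Fin 2) → ℝ} (hf : IsAffine f) (hg : IsAffine g) :
    IsAffine (fun x => f x - g x) := by
  simpa [sub_eq_add_neg] using hf.add (hg.const_mul (-1))

lemma sum {I : Type} (s : Finset I) {f : I → (ι → Fin 2) → ℝ} (hf : ∀ i, IsAffine (f i)) :
    IsAffine (fun x => ∑ i ∈ s, f i x) := by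
  classical
  induction s using Finset.induction_on with
  | empty => simpa using const 0
  | insert a s ha ih => simpa [Finset.sum_insert ha] using (hf a).add ih

/-- Substituting affine functions for the coordinates keeps a function affine. -/
lemma comp {g : (κ → Fin 2) → ℝ} (hg : IsAffine g) {φ : (ι → Fin 2) → κ → Fin 2}
    (hφ : ∀ k, IsAffine (fun x => ((φ x k : ℕ) : ℝ))) : IsAffine (fun x => g (φ x)) := by
  obtain ⟨c, v, h⟩ := hg
  simp only [h]
  exact (const c).add (sum _ fun k => (hφ k).const_mul (v k))

lemma comp_coords {g : (κ → Fin 2) → ℝ} (hg : IsAffine g) (e : κ → ι) :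
    IsAffine (fun x : ι → Fin 2 => g (x ∘ e)) :=
  hg.comp fun k => coord (e k)

lemma comp_elim {g : (κ ⊕ ι → Fin 2) → ℝ} (hg : IsAffine g) (u : κ → Fin 2) :
    IsAffine (fun x : ι → Fin 2 => g (Sum.elim u x)) :=
  hg.comp fun k => by
    cases k with
    | inl k => simpa using const _
    | inr i => simpa using coord i

/-- On the cube, the Hamming distance to a fixed vertex is affine. -/
lemma hammingDist (w : ι → Fin 2) :
    IsAffine (fun x => (_root_.hammingDist x w : ℝ)) := by
  have h : ∀ x : ι → Fin 2, (_root_.hammingDist x w : ℝ) =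
      ∑ i, (((w i : ℕ) : ℝ) + (1 - 2 * ((w i : ℕ) : ℝ)) * ((x i : ℕ) : ℝ)) := by
    intro x
    rw [_root_.hammingDist, Finset.card_filter]
    push_cast
    refine Finset.sum_congr rfl fun i _ => ?_
    generalize x i = a
    generalize w i = b
    fin_cases a <;> fin_cases b <;> norm_num
  simp only [h]
  exact sum _ fun i => (const _).add ((coord i).const_mul _)

lemma hammingNorm : IsAffine (fun x : ι → Fin 2 => (_root_.hammingNorm x : ℝ)) := by
  simpa using hammingDist (0 : ι → Fin 2)

end IsAffine

/-- The affine interpolation of the values of `ψ` at the origin and at the unit vectors. -/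
noncomputable def starInterp {κ : Type} [Fintype κ] [DecidableEq κ] (ψ : (κ → Fin 2) → ℝ)
    (v : κ → Fin 2) : ℝ :=
  ψ 0 + ∑ i, (ψ (Pi.single i 1) - ψ 0) * ((v i : ℕ) : ℝ)

lemma isAffine_starInterp {κ : Type} [Fintype κ] [DecidableEq κ] (ψ : (κ → Fin 2) → ℝ) :
    IsAffine (starInterp ψ) :=
  ⟨ψ 0, fun i => ψ (Pi.single i 1) - ψ 0, fun _ => rfl⟩

/-- A vertex of Hamming weight at most one is the origin or a unit vector. -/
lemma eq_zero_or_single {κ : Type} [Fintype κ] [DecidableEq κ] {v : κ → Fin 2}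
    (hv : hammingNorm v ≤ 1) : v = 0 ∨ ∃ i, v = Pi.single i 1 := by
  rcases Nat.le_one_iff_eq_zero_or_eq_one.mp hv with h | h
  · exact Or.inl (hammingNorm_eq_zero.mp h)
  · right
    obtain ⟨i, hi⟩ := Finset.card_eq_one.mp h
    refine ⟨i, funext fun j => ?_⟩
    have hj : v j ≠ 0 ↔ j = i := by
      simpa using Finset.ext_iff.mp hi j
    by_cases hji : j = i
    · subst hji
      simpa using Fin.eq_one_of_ne_zero _ (hj.mpr rfl)
    · rw [Pi.single_eq_of_ne hji]
      by_contra h0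
      exact hji (hj.mp h0)

lemma starInterp_eq {κ : Type} [Fintype κ] [DecidableEq κ] (ψ : (κ → Fin 2) → ℝ)
    {v : κ → Fin 2} (hv : hammingNorm v ≤ 1) : starInterp ψ v = ψ v := by
  rcases eq_zero_or_single hv with rfl | ⟨i, rfl⟩
  · simp [starInterp]
  · rw [starInterp, Finset.sum_eq_single i]
    · simp
    · intro j _ hj
      simp [Pi.single_eq_of_ne hj]
    · simp

/-- There are at most `2^d - (d+1)` vertices of Hamming weight at least two. -/
lemma card_two_le_hammingNorm (d : ℕ) :
    Fintype.card {v : Fin d → Fin 2 // 2 ≤ hammingNorm v} ≤ 2 ^ d - (d + 1) := by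
  classical
  have h1 : d + 1 ≤ Fintype.card {v : Fin d → Fin 2 // ¬ 2 ≤ hammingNorm v} := by
    let g : Option (Fin d) → {v : Fin d → Fin 2 // ¬ 2 ≤ hammingNorm v} := fun o =>
      ⟨o.elim 0 fun i => Pi.single i 1, by
        cases o with
        | none => simp
        | some i =>
          have : hammingNorm (Pi.single i 1 : Fin d → Fin 2) ≤ 1 := by
            rw [hammingNorm, Finset.card_le_one]
            intro a ha b hb
            simp [Pi.single_apply] at ha hb
            rw [ha, hb]
          simp only [Option.elim]
          omega⟩
    have hg : Function.Injective g := by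
      intro a b hab
      have hab' := congrArg Subtype.val hab
      cases a with
      | none =>
        cases b with
        | none => rfl
        | some j => simpa [g] using congrFun hab' j
      | some i =>
        have h := congrFun hab' i
        cases b with
        | none => simp [g] at h
        | some j =>
          by_cases hij : i = j
          · rw [hij]
          · simp [g, Pi.single_eq_of_ne hij] at h
    simpa using Fintype.card_le_of_injective g hg
  rw [Fintype.card_subtype_compl] at h1
  have h2 : Fintype.card {v : Fin d → Fin 2 // 2 ≤ hammingNorm v} ≤ 2 ^ d := by
    simpa using Fintype.card_subtype_le fun v : Fin d → Fin 2 => 2 ≤ hammingNorm v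
  simp at h1
  omega

/-! ### Limits -/

lemma tendsto_one_add_exp {f : ℕ → ℝ} (hf : Tendsto f atTop atBot) :
    Tendsto (fun s => 1 + Real.exp (f s)) atTop (𝓝 1) := by
  simpa using (Real.tendsto_exp_atBot.comp hf).const_add 1

lemma tendsto_one_add_exp_div_exp {f : ℕ → ℝ} (hf : Tendsto f atTop atTop) :
    Tendsto (fun s => (1 + Real.exp (f s)) / Real.exp (f s)) atTop (𝓝 1) := by
  have h : (fun s => (1 + Real.exp (f s)) / Real.exp (f s)) = fun s => 1 + Real.exp (-f s) := by
    funext s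
    rw [add_div, div_self (Real.exp_ne_zero _), Real.exp_neg, add_comm, one_div]
  rw [h]
  exact tendsto_one_add_exp (tendsto_neg_atTop_atBot.comp hf)

lemma tendsto_exp_neg_mul_one_add_exp {f : ℕ → ℝ} (hf : Tendsto f atTop atTop) (c : ℝ) :
    Tendsto (fun s => Real.exp (-f s) * (1 + Real.exp (f s + c))) atTop
      (𝓝 (Real.exp c)) := by
  have h : (fun s => Real.exp (-f s) * (1 + Real.exp (f s + c))) =
      fun s => Real.exp (-f s) + Real.exp c := by
    funext s
    rw [mul_add, ← Real.exp_add]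
    simp
  rw [h]
  simpa using (Real.tendsto_exp_atBot.comp (tendsto_neg_atTop_atBot.comp hf)).add_const
    (Real.exp c)

lemma tendsto_prod_one {I : Type} [Fintype I] {P : I → ℕ → ℝ}
    (h : ∀ i, Tendsto (P i) atTop (𝓝 1)) : Tendsto (fun s => ∏ i, P i s) atTop (𝓝 1) := by
  simpa using tendsto_finsetProd Finset.univ fun i _ => h i

/-- In a product all of whose factors but one tend to `1`, only that one matters. -/
lemma tendsto_mul_prod_of_ne {I : Type} [Fintype I] (i₀ : I) {P : I → ℕ → ℝ}
    {g : ℕ → ℝ} {L : ℝ} (hne : ∀ i, i ≠ i₀ → Tendsto (P i) atTop (𝓝 1))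
    (h₀ : Tendsto (fun s => g s * P i₀ s) atTop (𝓝 L)) :
    Tendsto (fun s => g s * ∏ i, P i s) atTop (𝓝 L) := by
  classical
  have h : Tendsto (fun s => ∏ i ∈ Finset.univ.erase i₀, P i s) atTop (𝓝 1) := by
    simpa using tendsto_finsetProd (Finset.univ.erase i₀)
      fun i hi => hne i (Finset.ne_of_mem_erase hi)
  have := h₀.mul h
  rw [mul_one] at this
  refine this.congr fun s => ?_
  rw [mul_assoc, Finset.mul_prod_erase _ (fun i => P i s) (Finset.mem_univ i₀)]

/-- Finitely many real sequences are dominated by a single one. -/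
lemma exists_dominating {I : Type} [Fintype I] (f : I → ℕ → ℝ) :
    ∃ K : ℕ → ℝ, Tendsto K atTop atTop ∧ ∀ i, ∀ c : ℝ, 1 ≤ c →
      Tendsto (fun s => f i s - K s * c) atTop atBot ∧
      Tendsto (fun s => f i s + K s * c) atTop atTop := by
  have hcast : Tendsto (fun s : ℕ => (s : ℝ)) atTop atTop := tendsto_natCast_atTop_atTop
  have hK : ∀ (i : I) (s : ℕ), (s : ℝ) + |f i s| ≤ s + ∑ i, |f i s| := fun i s => by
    gcongr
    exact Finset.single_le_sum (f := fun i => |f i s|) (fun _ _ => abs_nonneg _)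
      (Finset.mem_univ i)
  have hK' : ∀ s : ℕ, (s : ℝ) ≤ s + ∑ i, |f i s| := fun s =>
    le_add_of_nonneg_right (Finset.sum_nonneg fun _ _ => abs_nonneg _)
  refine ⟨fun s => s + ∑ i, |f i s|, tendsto_atTop_mono hK' hcast, fun i c hc => ⟨?_, ?_⟩⟩
  · refine tendsto_atBot_mono (fun s => ?_) (tendsto_neg_atTop_atBot.comp hcast)
    have h1 := hK i s
    have h2 : (s + ∑ i, |f i s|) * 1 ≤ (s + ∑ i, |f i s|) * c :=
      mul_le_mul_of_nonneg_left hc ((Nat.cast_nonneg s).trans (hK' s))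
    have h3 := le_abs_self (f i s)
    simp only [Function.comp]
    linarith
  · refine tendsto_atTop_mono (fun s => ?_) hcast
    have h1 := hK i s
    have h2 : (s + ∑ i, |f i s|) * 1 ≤ (s + ∑ i, |f i s|) * c :=
      mul_le_mul_of_nonneg_left hc ((Nat.cast_nonneg s).trans (hK' s))
    have h3 := neg_abs_le (f i s)
    linarith


/-! ### Steering schemes -/

/-- A limiting statement about products of factors `1 + exp (affine function)` on `{0,1}^ι`, which
says that `J` hidden units suffice per output state to steer that output state, in the presence of
`Q` further units.

The factors indexed by `Q` are fixed beforehand (depending on a parameter `s → ∞`); they will only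
raise the weight of the output state `0`. Given a penalty `exp (-α s)` of some other output state,
with `α s` affine and divergent, and any positive target `ψ`, the factors indexed by `J` can then be
chosen such that the weight of this output state relative to that of `0` tends to `ψ`. -/
def Steerable (ι J Q : Type) [Fintype ι] [Fintype J] [Fintype Q] : Prop :=
  ∃ h : Q → ℕ → (ι → Fin 2) → ℝ, (∀ q s, IsAffine (h q s)) ∧
    ∀ (ψ : (ι → Fin 2) → ℝ) (α : ℕ → (ι → Fin 2) → ℝ), (∀ x, 0 < ψ x) →
      (∀ s, IsAffine (α s)) → (∀ x, Tendsto (fun s => α s x) atTop atTop) →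
      ∃ a : J → ℕ → (ι → Fin 2) → ℝ, (∀ j s, IsAffine (a j s)) ∧
        ∀ x, Tendsto (fun s => Real.exp (-α s x) * (∏ j, (1 + Real.exp (a j s x))) /
          ∏ q, (1 + Real.exp (h q s x))) atTop (𝓝 (ψ x))

/-- On an edge every function is affine, so one unit suffices. -/
lemma steerable_edge : Steerable (Fin 1) Unit Empty := by
  refine ⟨fun q => q.elim, fun q => q.elim, fun ψ α hψ hα hlim => ?_⟩
  refine ⟨fun _ s x => α s x + starInterp (fun v => Real.log (ψ v)) x,
    fun _ s => (hα s).add (isAffine_starInterp _), fun x => ?_⟩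
  have hx : hammingNorm x ≤ 1 := by
    simpa [hammingNorm] using Finset.card_le_univ (Finset.univ.filter fun i => x i ≠ 0)
  have := tendsto_exp_neg_mul_one_add_exp (hlim x) (Real.log (ψ x))
  rw [Real.exp_log (hψ x)] at this
  simpa [starInterp_eq _ hx] using this

lemma Steerable.congr {ι κ J Q : Type} [Fintype ι] [Fintype κ] [Fintype J] [Fintype Q]
    (e : ι ≃ κ) (H : Steerable ι J Q) : Steerable κ J Q := by
  obtain ⟨h, hh, H⟩ := H
  refine ⟨fun q s x => h q s (x ∘ e), fun q s => (hh q s).comp_coords e, fun ψ α hψ hα hlim => ?_⟩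
  obtain ⟨a, ha, hl⟩ := H (fun x => ψ (x ∘ e.symm)) (fun s x => α s (x ∘ e.symm))
    (fun x => hψ _) (fun s => (hα s).comp_coords e.symm) (fun x => hlim _)
  refine ⟨fun j s x => a j s (x ∘ e), fun j s => (ha j s).comp_coords e, fun x => ?_⟩
  have hx : (x ∘ e) ∘ e.symm = x := by
    funext i
    simp
  have := hl (x ∘ e)
  simp only [hx] at this
  exact this

/-- Free input bits are handled by a copy of the scheme on each of the parallel subcubes. -/
lemma Steerable.free {κ ι J Q : Type} [Fintype κ] [DecidableEq κ] [Fintype ι] [DecidableEq ι]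
    [Fintype J] [Fintype Q] (H : Steerable ι J Q) : Steerable (κ ⊕ ι) ((κ → Fin 2) × J) Q := by
  obtain ⟨h, hh, H⟩ := H
  refine ⟨fun q s x => h q s (x ∘ Sum.inr), fun q s => (hh q s).comp_coords _,
    fun ψ α hψ hα hlim => ?_⟩
  choose a ha hl using fun u : κ → Fin 2 =>
    H (fun x => ψ (Sum.elim u x)) (fun s x => α s (Sum.elim u x)) (fun _ => hψ _)
      (fun s => (hα s).comp_elim u) (fun _ => hlim _)
  obtain ⟨K, -, hK⟩ := exists_dominating
    fun (p : ((κ → Fin 2) × J) × (ι → Fin 2)) s => a p.1.1 p.1.2 s p.2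
  refine ⟨fun p s x => a p.1 p.2 s (x ∘ Sum.inr) - K s * hammingDist (x ∘ Sum.inl) p.1,
    fun p s => ((ha p.1 p.2 s).comp_coords _).sub
      (((IsAffine.hammingDist p.1).comp_coords _).const_mul _), fun x => ?_⟩
  have hx := hl (x ∘ Sum.inl) (x ∘ Sum.inr)
  simp only [Sum.elim_comp_inl_inr] at hx
  have key := tendsto_mul_prod_of_ne (x ∘ Sum.inl)
    (g := fun s => Real.exp (-α s x) / ∏ q, (1 + Real.exp (h q s (x ∘ Sum.inr))))
    (P := fun u s => ∏ j, (1 + Real.exp (a u j s (x ∘ Sum.inr) -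
      K s * hammingDist (x ∘ Sum.inl) u))) (L := ψ x)
    (fun u hu => tendsto_prod_one fun j => tendsto_one_add_exp
      (hK ((u, j), x ∘ Sum.inr) _ (by exact_mod_cast hammingDist_pos.mpr hu.symm)).1)
    (by
      refine hx.congr fun s => ?_
      simp only [hammingDist_self, Nat.cast_zero, mul_zero, sub_zero]
      ring)
  refine key.congr fun s => ?_
  rw [Fintype.prod_prod_type]
  ring

/-- Among the thresholds `2, …, d + 1`, one is critical for a point of Hamming weight `|v| ≥ 2`: there
the factor is `1 + exp h`. The factors with smaller thresholds become log-affine, and those with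
larger thresholds become trivial. -/
lemma tendsto_prod_threshold {d : ℕ} {v : Fin (d + 1) → Fin 2} (hv : 2 ≤ hammingNorm v)
    {Q X : Type} [Fintype Q] {h : Q → ℕ → X → ℝ} {K : ℕ → ℝ} {x : X}
    (hK : ∀ q, ∀ c : ℝ, 1 ≤ c → Tendsto (fun s => h q s x - K s * c) atTop atBot ∧
      Tendsto (fun s => h q s x + K s * c) atTop atTop) :
    Tendsto (fun s => (∏ p : Q × Fin d, (1 + Real.exp (h p.1 s x +
        K s * ((hammingNorm v : ℝ) - (p.2 + 2))))) /
      (Real.exp (∑ p : Q × Fin d, if (p.2 : ℕ) + 2 < hammingNorm v then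
        h p.1 s x + K s * ((hammingNorm v : ℝ) - (p.2 + 2)) else 0) *
        ∏ q, (1 + Real.exp (h q s x)))) atTop (𝓝 1) := by
  have hvd : hammingNorm v ≤ d + 1 := by
    simpa using hammingNorm_le_card_fintype (x := v)
  let c₀ : Fin d := ⟨hammingNorm v - 2, by omega⟩
  have hc₀ : ∀ c : Fin d, c = c₀ ↔ (c : ℕ) + 2 = hammingNorm v := fun c => by
    rw [Fin.ext_iff]
    simp only [c₀]
    omega
  have hfac : ∀ p : Q × Fin d, Tendsto (fun s => (1 + Real.exp (h p.1 s x +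
      K s * ((hammingNorm v : ℝ) - (p.2 + 2)))) /
      (Real.exp (if (p.2 : ℕ) + 2 < hammingNorm v then
        h p.1 s x + K s * ((hammingNorm v : ℝ) - (p.2 + 2)) else 0) *
        if p.2 = c₀ then 1 + Real.exp (h p.1 s x) else 1)) atTop (𝓝 1) := by
    rintro ⟨q, c⟩
    simp only [hc₀]
    rcases lt_trichotomy ((c : ℕ) + 2) (hammingNorm v) with hlt | heq | hgt
    · simp only [hlt, hlt.ne, if_true, if_false, mul_one]
      refine tendsto_one_add_exp_div_exp (hK q _ ?_).2
      have : ((c : ℕ) : ℝ) + 2 + 1 ≤ hammingNorm v := by exact_mod_cast hlt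
      linarith
    · have h0 : (hammingNorm v : ℝ) - ((c : ℕ) + 2) = 0 := by
        rw [← heq]
        push_cast
        ring
      simp only [heq, lt_irrefl, if_true, if_false, h0, mul_zero, add_zero, Real.exp_zero, one_mul]
      refine tendsto_const_nhds.congr fun s => ?_
      rw [div_self (by positivity)]
    · simp only [hgt.not_gt, hgt.ne', if_false, Real.exp_zero, mul_one, div_one]
      refine tendsto_one_add_exp ?_
      have : (hammingNorm v : ℝ) + 1 ≤ ((c : ℕ) : ℝ) + 2 := by exact_mod_cast hgt
      have h1 := (hK q (((c : ℕ) : ℝ) + 2 - hammingNorm v) (by linarith)).1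
      refine h1.congr fun s => ?_
      ring
  refine (tendsto_prod_one hfac).congr fun s => ?_
  rw [Finset.prod_div_distrib, Finset.prod_mul_distrib, Real.exp_sum]
  congr 2
  rw [Fintype.prod_prod_type]
  simp

/-- The recursive construction. In each subcube `{0,1}^(d+1) × {x'}` one unit steers the star of the
points `(v, x')` with `|v| ≤ 1`, on which every function is affine. It changes the ratios at
`|v| ≥ 2` by an affine extrapolation, but there the base units, whose product is log-convex enough
in `v`, push the ratios down again, so that the given scheme can be applied in each of the subcubes
`{v} × {0,1}^ι` with `|v| ≥ 2`.

The base units of the given scheme must not act at `|v| ≤ 1`, and must act, up to a log-affine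
factor, on all subcubes `{v} × {0,1}^ι` with `|v| ≥ 2`. This is achieved by using a copy of each of
them for each threshold `2, …, d+1` of the Hamming weight of `v`. -/
lemma Steerable.star {ι J Q : Type} [Fintype ι] [DecidableEq ι] [Fintype J] [Fintype Q] (d : ℕ)
    (H : Steerable ι J Q) :
    Steerable (Fin (d + 1) ⊕ ι)
      ((ι → Fin 2) ⊕ ({v : Fin (d + 1) → Fin 2 // 2 ≤ hammingNorm v} × J))
      (Option (Q × Fin d)) := by
  obtain ⟨h, hh, H⟩ := H
  obtain ⟨K, hKtop, hK⟩ := exists_dominating fun (p : Q × (ι → Fin 2)) s => h p.1 s p.2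
  let base : Option (Q × Fin d) → ℕ → (Fin (d + 1) ⊕ ι → Fin 2) → ℝ := fun o s x =>
    o.elim (K s * (2 * hammingNorm (x ∘ Sum.inl) - 3)) fun p =>
      h p.1 s (x ∘ Sum.inr) + K s * (hammingNorm (x ∘ Sum.inl) - (p.2 + 2))
  have hnorm : IsAffine fun x : Fin (d + 1) ⊕ ι → Fin 2 => (hammingNorm (x ∘ Sum.inl) : ℝ) :=
    IsAffine.hammingNorm.comp_coords _
  refine ⟨base, ?_, fun ψ α hψ hα hlim => ?_⟩
  · rintro (_ | p) s
    · exact ((hnorm.const_mul 2).sub (IsAffine.const 3)).const_mul _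
    · exact ((hh p.1 s).comp_coords _).add ((hnorm.sub (IsAffine.const _)).const_mul _)
  -- the logarithms of the ratios that the star units produce, extrapolated to the whole cube
  let L : (ι → Fin 2) → (Fin (d + 1) → Fin 2) → ℝ := fun w =>
    starInterp fun v => Real.log (ψ (Sum.elim v w))
  -- the log-affine part of the base factors in the subcube above `v`
  let β : {v : Fin (d + 1) → Fin 2 // 2 ≤ hammingNorm v} → ℕ → (ι → Fin 2) → ℝ := fun v s w =>
    K s * (2 * hammingNorm v.1 - 3) + ∑ p : Q × Fin d,
      if (p.2 : ℕ) + 2 < hammingNorm v.1 then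
        h p.1 s w + K s * ((hammingNorm v.1 : ℝ) - (p.2 + 2)) else 0
  have hβaff : ∀ v s, IsAffine (β v s) := fun v s => by
    refine (IsAffine.const _).add (IsAffine.sum _ fun p => ?_)
    split_ifs
    · exact (hh p.1 s).add (IsAffine.const _)
    · exact IsAffine.const 0
  have hbig : ∀ v : {v : Fin (d + 1) → Fin 2 // 2 ≤ hammingNorm v},
      Tendsto (fun s => K s * (2 * hammingNorm v.1 - 3)) atTop atTop := fun v => by
    refine hKtop.atTop_mul_const ?_
    have : (2 : ℝ) ≤ hammingNorm v.1 := by exact_mod_cast v.2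
    linarith
  have hβtop : ∀ v w, Tendsto (fun s => β v s w) atTop atTop := fun v w => by
    refine tendsto_atTop_add_right_of_le' _ 0 (hbig v) ?_
    have hp : ∀ p : Q × Fin d, ∀ᶠ s in atTop, 0 ≤ if (p.2 : ℕ) + 2 < hammingNorm v.1 then
        h p.1 s w + K s * ((hammingNorm v.1 : ℝ) - (p.2 + 2)) else 0 := fun p => by
      split_ifs with hlt
      · refine ((hK (p.1, w) _ ?_).2).eventually_ge_atTop 0
        have : ((p.2 : ℕ) : ℝ) + 2 + 1 ≤ hammingNorm v.1 := by exact_mod_cast hlt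
        linarith
      · simp
    filter_upwards [eventually_all.mpr hp] with s hs
    exact Finset.sum_nonneg fun p _ => hs p
  choose a ha hl using fun v => H (fun w => ψ (Sum.elim v.1 w) / Real.exp (L w v.1)) (β v)
    (fun _ => div_pos (hψ _) (Real.exp_pos _)) (hβaff v) (hβtop v)
  obtain ⟨M, -, hM⟩ := exists_dominating
    fun (p : ((ι → Fin 2) × (Fin (d + 1) ⊕ ι → Fin 2)) ⊕
      (({v : Fin (d + 1) → Fin 2 // 2 ≤ hammingNorm v} × J) × (ι → Fin 2))) s =>
      p.elim (fun p => α s p.2 + L p.1 (p.2 ∘ Sum.inl)) fun p => a p.1.1 p.1.2 s p.2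
  refine ⟨fun o s x => o.elim
    (fun w => α s x + L w (x ∘ Sum.inl) - M s * hammingDist (x ∘ Sum.inr) w)
    (fun p => a p.1 p.2 s (x ∘ Sum.inr) - M s * hammingDist (x ∘ Sum.inl) p.1.1), ?_, ?_⟩
  · rintro (w | p) s
    · exact ((hα s).add ((isAffine_starInterp _).comp_coords _)).sub
        (((IsAffine.hammingDist w).comp_coords _).const_mul _)
    · exact ((ha p.1 p.2 s).comp_coords _).sub
        (((IsAffine.hammingDist p.1.1).comp_coords _).const_mul _)
  intro x
  obtain ⟨v, w, rfl⟩ : ∃ v w, x = Sum.elim v w := ⟨_, _, (Sum.elim_comp_inl_inr x).symm⟩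
  simp only [Fintype.prod_sum_type, Sum.elim_inl, Sum.elim_inr, Sum.elim_comp_inl,
    Sum.elim_comp_inr, Fintype.prod_option, base, Option.elim]
  -- the effect of the star units: only the one at `w` matters
  have hstar : Tendsto (fun s => Real.exp (-α s (Sum.elim v w)) * ∏ w' : ι → Fin 2,
      (1 + Real.exp (α s (Sum.elim v w) + L w' v - M s * hammingDist w w'))) atTop
      (𝓝 (Real.exp (L w v))) := by
    refine tendsto_mul_prod_of_ne w (fun w' hw' => tendsto_one_add_exp ?_) ?_
    · have := (hM (Sum.inl (w', Sum.elim v w)) (hammingDist w w')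
        (by exact_mod_cast hammingDist_pos.mpr hw'.symm)).1
      simpa using this
    · simpa using tendsto_exp_neg_mul_one_add_exp (hlim (Sum.elim v w)) (L w v)
  have hother : ∀ u : {v : Fin (d + 1) → Fin 2 // 2 ≤ hammingNorm v}, v ≠ u.1 →
      Tendsto (fun s => ∏ j, (1 + Real.exp (a u j s w - M s * hammingDist v u.1))) atTop
        (𝓝 1) := fun u hu => tendsto_prod_one fun j => tendsto_one_add_exp <| by
    have := (hM (Sum.inr ((u, j), w)) (hammingDist v u.1)
      (by exact_mod_cast hammingDist_pos.mpr hu)).1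
    simpa using this
  by_cases hv : 2 ≤ hammingNorm v
  · have hlow := tendsto_mul_prod_of_ne (⟨v, hv⟩ : {v : Fin (d + 1) → Fin 2 // 2 ≤ hammingNorm v})
      (g := fun s => Real.exp (-β ⟨v, hv⟩ s w) / ∏ q, (1 + Real.exp (h q s w)))
      (P := fun u s => ∏ j, (1 + Real.exp (a u j s w - M s * hammingDist v u.1)))
      (L := ψ (Sum.elim v w) / Real.exp (L w v))
      (fun u hu => hother u fun e => hu (Subtype.ext e.symm))
      (by
        refine (hl ⟨v, hv⟩ w).congr fun s => ?_
        simp only [hammingDist_self, Nat.cast_zero, mul_zero, sub_zero]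
        ring)
    have hthr := tendsto_prod_threshold hv (h := h) (K := K) (x := w) fun q => hK (q, w)
    have hbase := (tendsto_one_add_exp_div_exp (hbig ⟨v, hv⟩)).mul hthr
    have htot := (hstar.mul hlow).div hbase (by norm_num)
    rw [mul_one, div_one, mul_div_cancel₀ _ (Real.exp_ne_zero _)] at htot
    refine htot.congr fun s => ?_
    have hA : (0 : ℝ) < ∏ q, (1 + Real.exp (h q s w)) :=
      Finset.prod_pos fun q _ => by positivity
    have hB : (0 : ℝ) < ∏ p : Q × Fin d, (1 + Real.exp (h p.1 s w +
        K s * ((hammingNorm v : ℝ) - (p.2 + 2)))) :=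
      Finset.prod_pos fun q _ => by positivity
    simp only [Pi.div_apply, β, Real.exp_neg, Real.exp_add, Fintype.prod_prod_type] at hB ⊢
    field_simp
  · have hv1 : hammingNorm v ≤ 1 := by omega
    have hLψ : Real.exp (L w v) = ψ (Sum.elim v w) := by
      simp only [L]
      rw [starInterp_eq _ hv1, Real.exp_log (hψ _)]
    have hlow : Tendsto (fun s => ∏ u : {v : Fin (d + 1) → Fin 2 // 2 ≤ hammingNorm v},
        ∏ j, (1 + Real.exp (a u j s w - M s * hammingDist v u.1))) atTop (𝓝 1) :=
      tendsto_prod_one fun u => hother u fun e => hv (e ▸ u.2)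
    have hv1' : (hammingNorm v : ℝ) ≤ 1 := by exact_mod_cast hv1
    have hnone : Tendsto (fun s => 1 + Real.exp (K s * (2 * hammingNorm v - 3))) atTop (𝓝 1) :=
      tendsto_one_add_exp (hKtop.atTop_mul_const_of_neg (by linarith))
    have hthr : Tendsto (fun s => ∏ p : Q × Fin d, (1 + Real.exp (h p.1 s w +
        K s * ((hammingNorm v : ℝ) - (p.2 + 2))))) atTop (𝓝 1) := by
      refine tendsto_prod_one fun p => tendsto_one_add_exp ?_
      have hp : (0 : ℝ) ≤ ((p.2 : ℕ) : ℝ) := Nat.cast_nonneg _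
      refine ((hK (p.1, w) (((p.2 : ℕ) : ℝ) + 2 - hammingNorm v) (by linarith)).1).congr
        fun s => ?_
      ring
    have htot := (hstar.mul hlow).div (hnone.mul hthr) (by norm_num)
    rw [mul_one, mul_one, div_one, hLψ] at htot
    refine htot.congr fun s => ?_
    simp only [Pi.div_apply, Fintype.prod_prod_type]
    ring

/-! ### Number of units in the recursive scheme -/

/-- A bound for the number of base units that the recursive scheme in dimension `S r` needs. The
value at `1` is `0`, as an edge needs none; the value at `0` is not used. -/
def baseCount : ℕ → ℕ
  | 0 => 0
  | 1 => 0
  | r + 2 => baseCount (r + 1) * (r + 1) + 1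

lemma S_succ (r : ℕ) : S (r + 1) = S r + (r + 1) :=
  Finset.sum_Icc_succ_top (by omega) _

lemma add_le_two_pow_add_three (r : ℕ) : r + 3 + (r + 4) ≤ 2 ^ (r + 3) := by
  induction r with
  | zero => norm_num
  | succ r ih =>
    rw [show r + 1 + 3 = r + 3 + 1 by ring, pow_succ]
    omega

lemma one_le_R (r : ℕ) : 1 ≤ R (r + 2) := by
  rw [R, if_neg (by omega)]
  refine Finset.one_le_prod' fun i hi => ?_
  have h2 := (Finset.mem_Icc.mp hi).1
  rcases eq_or_lt_of_le h2 with rfl | h3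
  · norm_num
  · obtain ⟨j, rfl⟩ := Nat.exists_eq_add_of_le' h3
    have := add_le_two_pow_add_three j
    change 1 ≤ 2 ^ (j + 3) - (j + 3 + 1)
    omega

lemma baseCount_le_R (r : ℕ) : baseCount (r + 1) ≤ R (r + 1) := by
  induction r with
  | zero => simp [baseCount]
  | succ r ih =>
    cases r with
    | zero => simpa [baseCount] using one_le_R 0
    | succ r =>
      have h1 := one_le_R r
      have hR : R (r + 3) = R (r + 2) * (2 ^ (r + 3) - (r + 4)) := by
        rw [R, R, if_neg (by omega), if_neg (by omega)]
        exact Finset.prod_Icc_succ_top (by omega) _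
      have h2 : r + 3 ≤ 2 ^ (r + 3) - (r + 4) := by
        have := add_le_two_pow_add_three r
        omega
      calc baseCount (r + 3) = baseCount (r + 2) * (r + 2) + 1 := rfl
        _ ≤ R (r + 2) * (r + 2) + R (r + 2) := Nat.add_le_add (Nat.mul_le_mul ih le_rfl) h1
        _ = R (r + 2) * (r + 3) := by ring
        _ ≤ R (r + 3) := hR ▸ Nat.mul_le_mul le_rfl h2

lemma exists_steerable (r : ℕ) : ∃ (J Q : Type) (_ : Fintype J) (_ : Fintype Q),
    Fintype.card J ≤ F (r + 1) ∧ Fintype.card Q ≤ baseCount (r + 1) ∧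
      Steerable (Fin (S (r + 1))) J Q := by
  induction r with
  | zero => exact ⟨Unit, Empty, inferInstance, inferInstance, by simp [F], by simp, steerable_edge⟩
  | succ r ih =>
    obtain ⟨J, Q, _, _, hJ, hQ, H⟩ := ih
    refine ⟨_, _, inferInstance, inferInstance, ?_, ?_, (H.star (r + 1)).congr
      (finSumFinEquiv.trans (finCongr (by rw [S_succ (r + 1)]; ring)))⟩
    · have hc := card_two_le_hammingNorm (r + 2)
      simp only [Fintype.card_sum, Fintype.card_prod, Fintype.card_pi, Fintype.card_fin,
        Finset.prod_const, Finset.card_univ, F, f]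
      exact Nat.add_le_add le_rfl (Nat.mul_le_mul hc hJ)
    · simp only [Fintype.card_option, Fintype.card_prod, Fintype.card_fin, baseCount]
      exact Nat.add_le_add (Nat.mul_le_mul hQ le_rfl) le_rfl

lemma exists_steerable_of_le {k r : ℕ} (hr : 1 ≤ r) (hk : S r ≤ k) :
    ∃ (J Q : Type) (_ : Fintype J) (_ : Fintype Q),
      Fintype.card J ≤ 2 ^ (k - S r) * F r ∧ Fintype.card Q ≤ baseCount r ∧
        Steerable (Fin k) J Q := by
  obtain ⟨r, rfl⟩ := Nat.exists_eq_add_of_le' hr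
  obtain ⟨J, Q, _, _, hJ, hQ, H⟩ := exists_steerable r
  refine ⟨_, Q, inferInstance, inferInstance, ?_, hQ,
    (H.free (κ := Fin (k - S (r + 1)))).congr
      (finSumFinEquiv.trans (finCongr (Nat.sub_add_cancel hk)))⟩
  simp only [Fintype.card_prod, Fintype.card_pi, Fintype.card_fin, Finset.prod_const,
    Finset.card_univ]
  exact Nat.mul_le_mul le_rfl hJ

/-! ### Weights as products over hidden units -/

open scoped Matrix in
/-- Summing out the hidden units turns the weight into a product with one factor for each of
them. -/
lemma weight_eq {k n m : ℕ} (V : Matrix (Fin m) (Fin k) ℝ) (W : Matrix (Fin m) (Fin n) ℝ)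
    (b : Fin n → ℝ) (c : Fin m → ℝ) (x : Cube k) (y : Cube n) :
    weight V W b c x y = Real.exp (b ⬝ᵥ toVec y) *
      ∏ j, (1 + Real.exp ((V *ᵥ toVec x) j + (W *ᵥ toVec y) j + c j)) := by
  have h : ∀ t : ℝ, 1 + Real.exp t = ∑ i : Fin 2, Real.exp (((i : ℕ) : ℝ) * t) := by
    intro t
    simp [Fin.sum_univ_two]
  simp only [h]
  rw [Finset.prod_univ_sum, Fintype.piFinset_univ, Finset.mul_sum, weight]
  refine Finset.sum_congr rfl fun z _ => ?_
  rw [← Real.exp_sum, ← Real.exp_add]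
  congr 1
  simp only [mul_add, Finset.sum_add_distrib]
  rw [dotProduct_comm c]
  simp only [dotProduct, toVec]
  ring

/-- Any product of at most `m` factors `1 + exp (affine function)` is a weight of the model, up to a
constant. -/
lemma exists_weight {k n m : ℕ} {U : Type} [Fintype U] (hU : Fintype.card U ≤ m)
    {g : U → Cube k → ℝ} {g' : U → Cube n → ℝ} {B : Cube n → ℝ} (hg : ∀ u, IsAffine (g u))
    (hg' : ∀ u, IsAffine (g' u)) (hB : IsAffine B) :
    ∃ (V : Matrix (Fin m) (Fin k) ℝ) (W : Matrix (Fin m) (Fin n) ℝ) (b : Fin n → ℝ)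
      (c : Fin m → ℝ) (C : ℝ), 0 < C ∧ ∀ x y,
        weight V W b c x y = C * (Real.exp (B y) * ∏ u, (1 + Real.exp (g u x + g' u y))) := by
  classical
  obtain ⟨b₀, b, hb⟩ := hB
  choose c V hV using hg
  choose c' W hW using hg'
  let e : Fin m ≃ U ⊕ Fin (m - Fintype.card U) := Fintype.equivOfCardEq (by simp; omega)
  refine ⟨Matrix.of fun j => Sum.elim V 0 (e j), Matrix.of fun j => Sum.elim W 0 (e j), b,
    fun j => Sum.elim (fun u => c u + c' u) 0 (e j),
    Real.exp (-b₀) * 2 ^ (m - Fintype.card U), by positivity, fun x y => ?_⟩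
  rw [weight_eq]
  simp only [Matrix.mulVec, dotProduct, toVec, Matrix.of_apply]
  rw [e.prod_comp fun o => 1 + Real.exp (∑ i, Sum.elim V 0 o i * ((x i : ℕ) : ℝ) +
    ∑ i, Sum.elim W 0 o i * ((y i : ℕ) : ℝ) + Sum.elim (fun u => c u + c' u) 0 o)]
  rw [Fintype.prod_sum_type, hb, Real.exp_add, Real.exp_neg]
  have h2 : ∀ u, c u + ∑ i, V u i * ((x i : ℕ) : ℝ) + (c' u + ∑ i, W u i * ((y i : ℕ) : ℝ)) =
      ∑ i, V u i * ((x i : ℕ) : ℝ) + ∑ i, W u i * ((y i : ℕ) : ℝ) + (c u + c' u) := fun u => by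
    ring
  simp only [hV, hW, h2, Sum.elim_inl, Sum.elim_inr, Pi.zero_apply, zero_mul,
    Finset.sum_const_zero, add_zero, Real.exp_zero, Finset.prod_const, Finset.card_univ,
    Fintype.card_fin]
  norm_num
  field_simp

lemma weight_pos {k n m : ℕ} (V : Matrix (Fin m) (Fin k) ℝ) (W : Matrix (Fin m) (Fin n) ℝ)
    (b : Fin n → ℝ) (c : Fin m → ℝ) (x : Cube k) (y : Cube n) : 0 < weight V W b c x y := by
  rw [weight]
  exact Finset.sum_pos (fun _ _ => Real.exp_pos _) Finset.univ_nonempty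

lemma normalized_weight_mem_model {k n m : ℕ} (V : Matrix (Fin m) (Fin k) ℝ)
    (W : Matrix (Fin m) (Fin n) ℝ) (b : Fin n → ℝ) (c : Fin m → ℝ) :
    (fun x y => weight V W b c x y / ∑ y' : Cube n, weight V W b c x y') ∈ model k n m := by
  refine ⟨fun x => ⟨fun y => ?_, ?_⟩, V, W, b, c, fun _ _ => rfl⟩
  · exact div_nonneg (weight_pos ..).le (Finset.sum_nonneg fun _ _ => (weight_pos ..).le)
  · rw [← Finset.sum_div]
    exact div_self (Finset.sum_pos (fun _ _ => weight_pos ..) Finset.univ_nonempty).ne'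

/-! ### Approximation of block-constant conditional distributions -/

/-- The first `l` bits of a binary vector of length `l + d`. -/
def block {l d : ℕ} (y : Cube (l + d)) : Cube l := y ∘ Fin.castAdd d

lemma sum_block {l d : ℕ} (g : Cube l → ℝ) :
    ∑ y : Cube (l + d), g (block y) = 2 ^ d * ∑ u, g u := by
  rw [← (Fin.appendEquiv l d (α := Fin 2)).sum_comp, Fintype.sum_prod_type, Finset.mul_sum]
  refine Finset.sum_congr rfl fun u _ => ?_
  have h : ∀ t : Fin d → Fin 2, block (Fin.append u t) = u := fun t => by
    funext i
    simp [block]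
  simp [Fin.appendEquiv, h]

/-- With one unit for each `j : J` and each nonzero block `y₀`, a steering scheme produces all
block-constant conditional distributions in the limit. The bias `-s` per bit of the block
concentrates the initial distribution on the block `0`; the units of the other blocks are then
negligible, because they are concentrated on their block. -/
lemma exists_weight_tendsto {k l d m : ℕ} {J Q : Type} [Fintype J] [Fintype Q]
    (H : Steerable (Fin k) J Q) (hm : Fintype.card J * (2 ^ l - 1) + Fintype.card Q ≤ m)
    {τ : Cube k → Cube l → ℝ} (hτ : ∀ x u, 0 < τ x u) :
    ∃ (V : ℕ → Matrix (Fin m) (Fin k) ℝ) (W : ℕ → Matrix (Fin m) (Fin (l + d)) ℝ)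
      (b : ℕ → Fin (l + d) → ℝ) (c : ℕ → Fin m → ℝ) (A : ℕ → Cube k → ℝ), (∀ s x, 0 < A s x) ∧
      ∀ x y, Tendsto (fun s => weight (V s) (W s) (b s) (c s) x y / A s x) atTop
        (𝓝 (τ x (block y) / τ x 0)) := by
  obtain ⟨h, hh, H⟩ := H
  have hnat : Tendsto (fun s : ℕ => (s : ℝ)) atTop atTop := tendsto_natCast_atTop_atTop
  have hnorm : ∀ u : {u : Cube l // u ≠ 0}, (1 : ℝ) ≤ hammingNorm u.1 := fun u => by
    exact_mod_cast hammingNorm_pos_iff.mpr u.2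
  choose a ha hl using fun u : {u : Cube l // u ≠ 0} =>
    H (fun x => τ x u / τ x 0) (fun s _ => s * hammingNorm u.1)
      (fun x => div_pos (hτ _ _) (hτ _ _)) (fun s => IsAffine.const _)
      (fun x => hnat.atTop_mul_const (by linarith [hnorm u]))
  obtain ⟨K, -, hK⟩ := exists_dominating
    fun (p : (Q × Cube k) ⊕ (({u : Cube l // u ≠ 0} × J) × Cube k)) s =>
      p.elim (fun p => h p.1 s p.2) fun p => a p.1.1 p.1.2 s p.2
  have hcard : Fintype.card (Q ⊕ ({u : Cube l // u ≠ 0} × J)) ≤ m := by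
    have : Fintype.card {u : Cube l // u ≠ 0} = 2 ^ l - 1 := by
      rw [Fintype.card_subtype_compl]
      simp
    simp only [Fintype.card_sum, Fintype.card_prod, this]
    rw [add_comm, mul_comm]
    exact hm
  choose V W b c C hC hw using fun s : ℕ => exists_weight (k := k) (n := l + d) hcard
    (g := fun o x => o.elim (fun q => h q s x) fun p => a p.1 p.2 s x)
    (g' := fun o y => o.elim (fun _ => (-K s) * hammingNorm (block y))
      fun p => (-K s) * hammingDist (block y) p.1.1)
    (B := fun y => (-s) * hammingNorm (block y))
    (by rintro (q | p); exacts [hh q s, ha p.1 p.2 s])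
    (by
      rintro (q | p)
      · exact (IsAffine.hammingNorm.comp_coords _).const_mul _
      · exact ((IsAffine.hammingDist _).comp_coords _).const_mul _)
    ((IsAffine.hammingNorm.comp_coords _).const_mul _)
  refine ⟨V, W, b, c, fun s x => C s * ∏ q, (1 + Real.exp (h q s x)),
    fun s x => mul_pos (hC s) (Finset.prod_pos fun q _ => by positivity), fun x y => ?_⟩
  have hA : ∀ s, (0 : ℝ) < ∏ q, (1 + Real.exp (h q s x)) := fun s =>
    Finset.prod_pos fun q _ => by positivity
  simp only [hw, Fintype.prod_sum_type, Sum.elim_inl, Sum.elim_inr]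
  have hother : ∀ u : {u : Cube l // u ≠ 0}, block y ≠ u.1 → Tendsto (fun s => ∏ j,
      (1 + Real.exp (a u j s x + (-K s) * hammingDist (block y) u.1))) atTop (𝓝 1) :=
    fun u hu => tendsto_prod_one fun j => tendsto_one_add_exp <| by
      refine ((hK (Sum.inr ((u, j), x)) (hammingDist (block y) u.1)
        (by exact_mod_cast hammingDist_pos.mpr hu)).1).congr fun s => ?_
      simp [sub_eq_add_neg]
  by_cases hy : block y = 0
  · have h1 : Tendsto (fun s => ∏ u : {u : Cube l // u ≠ 0}, ∏ j,
        (1 + Real.exp (a u j s x + (-K s) * hammingDist (block y) u.1))) atTop (𝓝 1) :=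
      tendsto_prod_one fun u => hother u fun e => u.2 (e ▸ hy)
    rw [hy, div_self (hτ _ _).ne']
    rw [hy] at h1
    refine h1.congr fun s => ?_
    have := (hA s).ne'
    have := (hC s).ne'
    simp only [Fintype.prod_prod_type, hammingNorm_zero, Nat.cast_zero, mul_zero, Real.exp_zero,
      add_zero]
    field_simp
  · have hbase : Tendsto (fun s => ∏ q, (1 + Real.exp (h q s x + (-K s) * hammingNorm (block y))))
        atTop (𝓝 1) := by
      refine tendsto_prod_one fun q => tendsto_one_add_exp ?_
      refine ((hK (Sum.inl (q, x)) (hammingNorm (block y)) (hnorm ⟨_, hy⟩)).1).congr fun s => ?_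
      simp [sub_eq_add_neg]
    have h1 := tendsto_mul_prod_of_ne (⟨block y, hy⟩ : {u : Cube l // u ≠ 0})
      (g := fun s : ℕ => Real.exp (-(s * hammingNorm (block y))) / ∏ q, (1 + Real.exp (h q s x)))
      (P := fun u s => ∏ j, (1 + Real.exp (a u j s x + (-K s) * hammingDist (block y) u.1)))
      (L := τ x (block y) / τ x 0)
      (fun u hu => hother u fun e => hu (Subtype.ext e.symm))
      (by
        refine (hl ⟨block y, hy⟩ x).congr fun s => ?_
        simp only [hammingDist_self, Nat.cast_zero, mul_zero, add_zero]
        ring)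
    have htot := h1.mul hbase
    rw [mul_one] at htot
    refine htot.congr fun s => ?_
    have := (hA s).ne'
    have := (hC s).ne'
    simp only [Fintype.prod_prod_type, neg_mul]
    field_simp

lemma exists_model_ge {k l d m : ℕ} {J Q : Type} [Fintype J] [Fintype Q]
    (H : Steerable (Fin k) J Q) (hm : Fintype.card J * (2 ^ l - 1) + Fintype.card Q ≤ m)
    {τ : Cube k → Cube l → ℝ} (hτ : ∀ x u, 0 < τ x u)
    (hsum : ∀ x, ∑ y : Cube (l + d), τ x (block y) = 1) {δ : ℝ} (hδ : δ < 1) :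
    ∃ q ∈ model k (l + d) m, ∀ x y, δ * τ x (block y) ≤ q x y := by
  obtain ⟨V, W, b, c, A, hA, hlim⟩ := exists_weight_tendsto (d := d) H hm hτ
  have hq : ∀ x y, Tendsto (fun s => weight (V s) (W s) (b s) (c s) x y /
      ∑ y', weight (V s) (W s) (b s) (c s) x y') atTop (𝓝 (τ x (block y))) := fun x y => by
    have h0 := (hτ x 0).ne'
    have hs : ∑ y : Cube (l + d), τ x (block y) / τ x 0 = 1 / τ x 0 := by
      rw [← Finset.sum_div, hsum]
    have h := (hlim x y).div (tendsto_finsetSum Finset.univ fun y' _ => hlim x y')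
      (by rw [hs]; exact one_div_ne_zero h0)
    rw [hs, div_div_div_cancel_right₀ h0, div_one] at h
    refine h.congr fun s => ?_
    simp only [Pi.div_apply]
    rw [← Finset.sum_div, div_div_div_cancel_right₀ (hA s x).ne']
  have hev : ∀ᶠ s in atTop, ∀ x y, δ * τ x (block y) ≤ weight (V s) (W s) (b s) (c s) x y /
      ∑ y', weight (V s) (W s) (b s) (c s) x y' :=
    eventually_all.mpr fun x => eventually_all.mpr fun y =>
      (hq x y).eventually_const_le (by nlinarith [hτ x (block y)])
  obtain ⟨s, hs⟩ := hev.exists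
  exact ⟨_, normalized_weight_mem_model .., hs⟩

/-! ### Divergence bounds -/

lemma klDivergence_le {n : ℕ} {p q : Cube n → ℝ} (hp : p ∈ stdSimplex ℝ (Cube n)) {κ : ℝ}
    (hκ : 0 < κ) (hpq : ∀ y, κ * p y ≤ q y) :
    ∃ D : ℝ, klDivergence p q = D ∧ D ≤ -Real.logb 2 κ := by
  refine ⟨∑ y, p y * Real.logb 2 (p y / q y), ?_, ?_⟩
  · rw [klDivergence, if_pos]
    intro y hy
    have h1 := hpq y
    rw [hy] at h1
    exact le_antisymm (by nlinarith) (hp.1 y)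
  · calc ∑ y, p y * Real.logb 2 (p y / q y) ≤ ∑ y, p y * -Real.logb 2 κ := by
          refine Finset.sum_le_sum fun y _ => ?_
          rcases (hp.1 y).eq_or_lt with h0 | h0
          · simp [← h0]
          · have hq : 0 < q y := (mul_pos hκ h0).trans_le (hpq y)
            refine mul_le_mul_of_nonneg_left ?_ h0.le
            rw [← Real.logb_inv]
            refine Real.logb_le_logb_of_le (by norm_num) (div_pos h0 hq) ?_
            rw [div_le_iff₀ hq, ← div_eq_inv_mul, le_div_iff₀ hκ]
            linarith [hpq y]
      _ = -Real.logb 2 κ := by rw [← Finset.sum_mul, hp.2, one_mul]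

lemma coe_finset_sum_ereal {I : Type} (s : Finset I) (g : I → ℝ) :
    ((∑ i ∈ s, g i : ℝ) : EReal) = ∑ i ∈ s, (g i : EReal) := by
  classical
  induction s using Finset.induction_on with
  | empty => simp
  | insert a s ha ih => rw [Finset.sum_insert ha, Finset.sum_insert ha, EReal.coe_add, ih]

lemma condDivergence_le {k n : ℕ} {p q : Cube k → Cube n → ℝ} (hp : p ∈ condDistributions k n)
    {κ : ℝ} (hκ : 0 < κ) (hpq : ∀ x y, κ * p x y ≤ q x y) :
    condDivergence p q ≤ ((-Real.logb 2 κ : ℝ) : EReal) := by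
  choose D hD hle using fun x => klDivergence_le (hp x) hκ (hpq x)
  have h : condDivergence p q = ((∑ x : Cube k, (1 / 2 ^ k : ℝ) * D x : ℝ) : EReal) := by
    rw [condDivergence, coe_finset_sum_ereal]
    exact Finset.sum_congr rfl fun x _ => by rw [hD, EReal.coe_mul]
  rw [h, EReal.coe_le_coe_iff]
  calc ∑ x : Cube k, (1 / 2 ^ k : ℝ) * D x ≤ ∑ _x : Cube k, (1 / 2 ^ k : ℝ) * -Real.logb 2 κ :=
        Finset.sum_le_sum fun x _ => mul_le_mul_of_nonneg_left (hle x) (by positivity)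
    _ = -Real.logb 2 κ := by simp

lemma maxDivergence_le {k n : ℕ} {M : Set (Cube k → Cube n → ℝ)} {D : ℝ}
    (h : ∀ p ∈ condDistributions k n, ∀ ρ : ℝ, 0 < ρ → ρ < 1 →
      ∃ q ∈ M, ∀ x y, ρ * 2 ^ (-D) * p x y ≤ q x y) : maxDivergence M ≤ (D : EReal) := by
  refine iSup₂_le fun p hp => EReal.le_of_forall_lt_iff_le.mp fun z hz => ?_
  have hz' : D < z := EReal.coe_lt_coe_iff.mp hz
  obtain ⟨q, hq, hpq⟩ := h p hp (2 ^ (D - z)) (by positivity)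
    (Real.rpow_lt_one_of_one_lt_of_neg (by norm_num) (by linarith))
  rw [← Real.rpow_add (by norm_num), show D - z + -D = -z by ring] at hpq
  refine (iInf₂_le q hq).trans ((condDivergence_le hp (by positivity) hpq).trans ?_)
  rw [Real.logb_rpow (by norm_num) (by norm_num), neg_neg]

/-- The block averages of `p`, mixed with a small amount of the uniform distribution, are bounded
from below by `2^(-d) p` up to a factor close to one. -/
lemma maxDivergence_model_le_of_steerable {k l d m : ℕ} {J Q : Type} [Fintype J] [Fintype Q]
    (H : Steerable (Fin k) J Q) (hm : Fintype.card J * (2 ^ l - 1) + Fintype.card Q ≤ m) :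
    maxDivergence (model k (l + d) m) ≤ ((d : ℝ) : EReal) := by
  refine maxDivergence_le fun p hp ρ h0 h1 => ?_
  set ε := √ρ with hε
  have hε0 : 0 < ε := Real.sqrt_pos.mpr h0
  have hε1 : ε < 1 := by rw [hε, Real.sqrt_lt' one_pos]; simpa using h1
  have hεε : ε * ε = ρ := Real.mul_self_sqrt h0.le
  let P : Cube k → Cube l → ℝ := fun x u => ∑ y : Cube (l + d), if block y = u then p x y else 0
  have hP0 : ∀ x u, 0 ≤ P x u := fun x u => Finset.sum_nonneg fun y _ => by
    split_ifs
    exacts [(hp x).1 y, le_rfl]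
  have hPsum : ∀ x, ∑ u, P x u = 1 := fun x => by
    simp only [P]
    rw [Finset.sum_comm]
    simpa using (hp x).2
  have hPp : ∀ x y, p x y ≤ P x (block y) := fun x y => by
    have := Finset.single_le_sum (f := fun y' => if block y' = block y then p x y' else 0)
      (fun y' _ => by split_ifs; exacts [(hp x).1 y', le_rfl]) (Finset.mem_univ y)
    simpa using this
  obtain ⟨q, hq, hle⟩ := exists_model_ge (d := d) H hm
    (τ := fun x u => (ε * P x u + (1 - ε) / 2 ^ l) / 2 ^ d)
    (fun x u => div_pos (add_pos_of_nonneg_of_pos (mul_nonneg hε0.le (hP0 x u))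
      (div_pos (by linarith) (by positivity))) (by positivity))
    (fun x => by
      rw [sum_block fun u => (ε * P x u + (1 - ε) / 2 ^ l) / 2 ^ d, ← Finset.sum_div,
        Finset.sum_add_distrib, ← Finset.mul_sum, hPsum]
      simp
      field_simp
      ring) hε1
  refine ⟨q, hq, fun x y => le_trans ?_ (hle x y)⟩
  rw [Real.rpow_neg (by norm_num), Real.rpow_natCast, ← hεε]
  calc ε * ε * (2 ^ d : ℝ)⁻¹ * p x y = ε * ((ε * p x y + 0) / 2 ^ d) := by ring
    _ ≤ ε * ((ε * P x (block y) + (1 - ε) / 2 ^ l) / 2 ^ d) := by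
      gcongr
      · exact hPp x y
      · exact div_nonneg (by linarith) (by positivity)

/-- The uniform distribution belongs to every model and has divergence at most `n`. -/
lemma maxDivergence_model_le (k n m : ℕ) :
    maxDivergence (model k n m) ≤ ((n : ℝ) : EReal) := by
  refine maxDivergence_le fun p hp ρ h0 h1 =>
    ⟨_, normalized_weight_mem_model 0 0 0 0, fun x y => ?_⟩
  have hp1 : p x y ≤ 1 := by
    rw [← (hp x).2]
    exact Finset.single_le_sum (fun y' _ => (hp x).1 y') (Finset.mem_univ y)
  have hw : weight (0 : Matrix (Fin m) (Fin k) ℝ) (0 : Matrix (Fin m) (Fin n) ℝ) 0 0 x y /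
      ∑ y' : Cube n, weight (0 : Matrix (Fin m) (Fin k) ℝ) (0 : Matrix (Fin m) (Fin n) ℝ) 0 0 x y'
      = (2 ^ n : ℝ)⁻¹ := by
    simp [weight]
    field_simp
  rw [hw, Real.rpow_neg (by norm_num), Real.rpow_natCast]
  calc ρ * (2 ^ n : ℝ)⁻¹ * p x y ≤ 1 * (2 ^ n : ℝ)⁻¹ * 1 := by
        gcongr
        exact (hp x).1 y
    _ = _ := by ring

/-- The bound with the number `baseCount r ≤ R r` of base units. -/
lemma maxDivergence_model_le_sub {k n m r l : ℕ} (hr : 1 ≤ r) (hk : S r ≤ k) (hl : l ≤ n)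
    (hm : (m : ℝ) ≥ 2 ^ (k - S r) * (F r : ℝ) * ((2 : ℝ) ^ l - 1) + (baseCount r : ℝ)) :
    maxDivergence (model k n m) ≤ (((n : ℝ) - (l : ℝ) : ℝ) : EReal) := by
  obtain ⟨J, Q, _, _, hJ, hQ, H⟩ := exists_steerable_of_le hr hk
  obtain ⟨d, rfl⟩ := Nat.exists_eq_add_of_le hl
  have h : Fintype.card J * (2 ^ l - 1) + Fintype.card Q ≤ m := by
    refine (Nat.add_le_add (Nat.mul_le_mul_right _ hJ) hQ).trans ?_
    have h1 : ((2 ^ l - 1 : ℕ) : ℝ) = 2 ^ l - 1 := by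
      rw [Nat.cast_sub Nat.one_le_two_pow]
      simp
    rw [← Nat.cast_le (α := ℝ)]
    push_cast [h1]
    exact hm
  simpa using maxDivergence_model_le_of_steerable (d := d) H h

end CRBM

theorem theorem3 (k n m : ℕ) :
    (∀ l : ℕ, 1 ≤ l → l ≤ n →
      (1 ≤ k → (m : ℝ) ≥ 1 / 2 * 2 ^ k * (2 ^ l - 1) →
        CRBM.maxDivergence (CRBM.model k n m) ≤ (((n : ℝ) - (l : ℝ) : ℝ) : EReal)) ∧
      (3 ≤ k → (m : ℝ) ≥ 3 / 8 * 2 ^ k * (2 ^ l - 1) + 1 →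
        CRBM.maxDivergence (CRBM.model k n m) ≤ (((n : ℝ) - (l : ℝ) : ℝ) : EReal)) ∧
      (21 ≤ k → (m : ℝ) ≥ 1 / 4 * 2 ^ k * (2 ^ l - 1 + 1 / 30) →
        CRBM.maxDivergence (CRBM.model k n m) ≤ (((n : ℝ) - (l : ℝ) : ℝ) : EReal))) ∧
    (∀ r : ℕ, 1 ≤ r → CRBM.S r ≤ k → ∀ l : ℤ, l ≤ n →
      (m : ℝ) ≥ 2 ^ (k - CRBM.S r) * (CRBM.F r : ℝ) * ((2 : ℝ) ^ l - 1) + (CRBM.R r : ℝ) →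
        CRBM.maxDivergence (CRBM.model k n m) ≤ (((n : ℝ) - (l : ℝ) : ℝ) : EReal)) := by
  refine ⟨fun l hl1 hln => ⟨fun hk hm => ?_, fun hk hm => ?_, fun hk hm => ?_⟩,
    fun r hr hk l hln hm => ?_⟩
  · obtain ⟨j, rfl⟩ := Nat.exists_eq_add_of_le' hk
    refine CRBM.maxDivergence_model_le_sub (r := 1) le_rfl (by simp [CRBM.S]) hln ?_
    simp only [CRBM.S, CRBM.F, CRBM.baseCount, Finset.Icc_self, Finset.sum_singleton,
      Nat.add_sub_cancel, Nat.cast_one, Nat.cast_zero]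
    refine le_of_eq_of_le ?_ hm
    ring
  · obtain ⟨j, rfl⟩ := Nat.exists_eq_add_of_le' hk
    have hS : CRBM.S 2 = 3 := by decide
    have hF : CRBM.F 2 = 3 := by decide
    have hG : CRBM.baseCount 2 = 1 := by decide
    refine CRBM.maxDivergence_model_le_sub (r := 2) (by norm_num) (by rw [hS]; omega) hln ?_
    rw [hS, hF, hG, Nat.add_sub_cancel]
    refine le_of_eq_of_le ?_ hm
    push_cast
    ring
  · obtain ⟨j, rfl⟩ := Nat.exists_eq_add_of_le' hk
    -- `512024 < 2^21 / 4 = 524288`, and `206 ≤ 2^21 / 120`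
    have hS : CRBM.S 6 = 21 := by decide
    have hF : CRBM.F 6 = 512024 := by norm_num [CRBM.F, CRBM.f, CRBM.S, Finset.sum_Icc_succ_top]
    have hG : CRBM.baseCount 6 = 206 := by decide
    refine CRBM.maxDivergence_model_le_sub (r := 6) (by norm_num) (by rw [hS]; omega) hln ?_
    rw [hS, hF, hG, Nat.add_sub_cancel]
    refine le_trans ?_ hm
    have h1 : (1 : ℝ) ≤ 2 ^ j := one_le_pow₀ (by norm_num)
    have h2 : (1 : ℝ) ≤ 2 ^ l := one_le_pow₀ (by norm_num)
    rw [pow_add]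
    push_cast
    nlinarith [mul_nonneg (sub_nonneg.mpr h2) (zero_le_one.trans h1)]
  · -- for `l ≤ 0` the hypothesis on `m` says little, but the uniform distribution is good enough
    rcases le_total l 0 with hl | hl
    · refine (CRBM.maxDivergence_model_le k n m).trans (EReal.coe_le_coe_iff.mpr ?_)
      have : (l : ℝ) ≤ 0 := by exact_mod_cast hl
      linarith
    · obtain ⟨l, rfl⟩ := Int.eq_ofNat_of_zero_le hl
      refine CRBM.maxDivergence_model_le_sub hr hk (by exact_mod_cast hln) ?_
      obtain ⟨r, rfl⟩ := Nat.exists_eq_add_of_le' hr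
      have hR : (CRBM.baseCount (r + 1) : ℝ) ≤ CRBM.R (r + 1) := by
        exact_mod_cast CRBM.baseCount_le_R r
      rw [zpow_natCast] at hm
      linarith
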